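/- Let $G=(V,E)$ be a simple graph, and for $x\in V$ let $N[x]=\{x\}\cup\{y\in V: xy\in E\}$ be its closed neighborhood. A (not necessarily proper) vertex coloring of $G$ is called conflict-free if for every $x\in V$ there is a vertex $y\in N[x]$ whose color is different from the color of each other vertex of $N[x]$. The conflict-free chromatic number $\chi_{CF}(G)$ is the smallest $r$ such that $G$ has a conflict-free coloring with $r$ colors. A set $S\subseteq V$ is dominating if each $v\in V$ is in $S$ or is adjacent to a vertex in $S$, and the domination number $D(G)$ is the smallest size of a dominating set of $G$. (Both numbers are taken in $\mathbb{N}\cup\{\infty\}$; for finite graphs they are finite.) Let $G(n,p)$ denote the binomial random graph on $n$ labeled vertices, in which each of the $\binom n2$ possible edges is present independently with probability $p$. Then every graph $G$ satisfies \[\chi_{CF}(G)\le D(G)+1.\] Furthermore, for every function $p=p(n)$ with $\frac12\le p(n)\le 1$ for all $n$, asymptotically almost surely \[D(G(n,p(n)))-3\le \chi_{CF}(G(n,p(n))),\] that is, the probability of this event tends to $1$ as $n\to\infty$. -/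

import Mathlib

namespace SimpleGraph

/-- The closed neighborhood `N[x] = N(x) ∪ {x}`. -/
def closedNeighborSet {V : Type*} (G : SimpleGraph V) (x : V) : Set V :=
  insert x (G.neighborSet x)

/-- A (not necessarily proper) vertex coloring `c` is conflict-free if for every vertex `x` there
is a vertex `y ∈ N[x]` whose color differs from the color of each other vertex of `N[x]`. -/
def IsConflictFree {V α : Type*} (G : SimpleGraph V) (c : V → α) : Prop :=
  ∀ x : V, ∃ y ∈ G.closedNeighborSet x, ∀ z ∈ G.closedNeighborSet x, z ≠ y → c z ≠ c y

/-- The conflict-free chromatic number: the smallest `r` such that there is a conflict-free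
coloring of `G` with `r` colors (`⊤` if there is none, which is impossible for finite graphs). -/
noncomputable def conflictFreeChromaticNumber {V : Type*} (G : SimpleGraph V) : ℕ∞ :=
  ⨅ (r : ℕ) (_ : ∃ c : V → Fin r, G.IsConflictFree c), (r : ℕ∞)

/-- `S` is a dominating set if each vertex is in `S` or is adjacent to a vertex of `S`. -/
def IsDominatingSet {V : Type*} (G : SimpleGraph V) (S : Set V) : Prop :=
  ∀ v : V, v ∈ S ∨ ∃ s ∈ S, G.Adj v s

/-- The domination number: the smallest size of a dominating set (`⊤` if there is no finite
dominating set, which is impossible for finite graphs). -/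
noncomputable def dominationNumber {V : Type*} (G : SimpleGraph V) : ℕ∞ :=
  ⨅ (S : Set V) (_ : G.IsDominatingSet S), S.encard

end SimpleGraph

/-!
Coloring a dominating set injectively and everything else with one more color is conflict-free.

For the lower bound write `q = 1 - p ≤ 1 / 2` and let `r` be the crossover at which `n * q ^ r` is
about `4 * r * log n`. A vertex sees a given color class exactly once only if the same holds on the
whole class, when that has at most two vertices, and otherwise only if it sees at most one of any
three vertices of the class; either way the probability is at most `p`, so a vertex sees none of
the `r` classes exactly once with probability at least `q ^ r`. There are only `n ^ O(r)` choices of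
these traces, so a union bound excludes conflict-free colorings with `r` colors. Three more
vertices than the `r + 1` that this leaves bring `n * q ^ (r + 4)` below `(r + 4) * log n / 2`,
where the second moment method yields a dominating set of size `r + 4`.
-/

section Colorings

open SimpleGraph Set

variable {V α β : Type*} {G : SimpleGraph V}

theorem isConflictFree_of_isDominatingSet {S : Set V} (hS : G.IsDominatingSet S) {c : V → α}
    (hc : ∀ s ∈ S, ∀ v, c v = c s → v = s) : G.IsConflictFree c := by
  intro x
  rcases hS x with hx | ⟨s, hs, hxs⟩
  · exact ⟨x, mem_insert _ _, fun z _ hzx hz ↦ hzx (hc x hx z hz)⟩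
  · exact ⟨s, mem_insert_of_mem _ hxs, fun z _ hzs hz ↦ hzs (hc s hs z hz)⟩

theorem isConflictFree_injective_comp {c : V → α} (hc : G.IsConflictFree c) {f : α → β}
    (hf : Function.Injective f) : G.IsConflictFree (f ∘ c) := fun x ↦
  let ⟨y, hy, hyc⟩ := hc x
  ⟨y, hy, fun z hz hzy ↦ hf.ne (hyc z hz hzy)⟩

theorem conflictFreeChromaticNumber_le_card [Fintype α] {c : V → α} (hc : G.IsConflictFree c) :
    G.conflictFreeChromaticNumber ≤ Fintype.card α :=
  iInf₂_le (Fintype.card α)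
    ⟨_, isConflictFree_injective_comp hc (Fintype.equivFin α).injective⟩

theorem exists_isConflictFree_of_conflictFreeChromaticNumber_le {r : ℕ}
    (h : G.conflictFreeChromaticNumber ≤ r) : ∃ c : V → Fin r, G.IsConflictFree c := by
  have hlt : G.conflictFreeChromaticNumber < (r + 1 : ℕ) :=
    h.trans_lt (by exact_mod_cast r.lt_succ_self)
  simp only [conflictFreeChromaticNumber, iInf_lt_iff] at hlt
  obtain ⟨k, ⟨c, hc⟩, hk⟩ := hlt
  have hkr : k ≤ r := Nat.lt_succ_iff.1 (by exact_mod_cast hk)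
  exact ⟨_, isConflictFree_injective_comp hc (Fin.castLE_injective hkr)⟩

theorem conflictFreeChromaticNumber_le_dominationNumber_add_one (G : SimpleGraph V) :
    G.conflictFreeChromaticNumber ≤ G.dominationNumber + 1 := by
  classical
  simp only [dominationNumber, ENat.iInf_add]
  refine le_iInf₂ fun S hS ↦ ?_
  rcases S.finite_or_infinite with hfin | hinf
  · have := hfin.fintype
    let c : V → Option S := fun v ↦ if hv : v ∈ S then some ⟨v, hv⟩ else none
    have hc : G.IsConflictFree c := isConflictFree_of_isDominatingSet hS fun s hs v hvs ↦ by
      by_cases hv : v ∈ S <;> simp_all [c]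
    calc G.conflictFreeChromaticNumber ≤ Fintype.card (Option S) :=
          conflictFreeChromaticNumber_le_card hc
      _ = S.encard + 1 := by rw [Fintype.card_option, Nat.cast_add_one, coe_fintypeCard]
  · simp [hinf.encard_eq]

theorem dominationNumber_le_card {S : Finset V} (hS : G.IsDominatingSet S) :
    G.dominationNumber ≤ S.card :=
  (iInf₂_le (S : Set V) hS).trans_eq (encard_coe_eq_coe_finsetCard S)

theorem dominationNumber_le_conflictFreeChromaticNumber_add {r k : ℕ}
    (hr : ¬ ∃ c : V → Fin r, G.IsConflictFree c) (hG : G.dominationNumber ≤ (r + 1 + k : ℕ)) :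
    G.dominationNumber ≤ G.conflictFreeChromaticNumber + k := by
  have hχ : (r + 1 : ℕ) ≤ G.conflictFreeChromaticNumber :=
    Order.add_one_le_of_lt (not_le.1 fun h ↦
      hr (exists_isConflictFree_of_conflictFreeChromaticNumber_le h))
  calc G.dominationNumber ≤ (r + 1 : ℕ) + k := hG
    _ ≤ G.conflictFreeChromaticNumber + k := by gcongr

end Colorings

section SetBernoulli

open MeasureTheory Measure ProbabilityTheory Set

variable {Ω ι κ : Type*} {mΩ : MeasurableSpace Ω} {P : Measure Ω} {p : unitInterval}

theorem iIndepFun_curry {κ : ι → Type*} {𝓧 : (i : ι) → κ i → Type*}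
    {m𝓧 : ∀ i j, MeasurableSpace (𝓧 i j)} {X : (i : ι) → (j : κ i) → Ω → 𝓧 i j}
    (mX : ∀ i j, Measurable (X i j))
    (h : iIndepFun (fun (q : (i : ι) × κ i) ω ↦ X q.1 q.2 ω) P) :
    iIndepFun (fun i ω ↦ (X i · ω)) P := by
  have := h.isProbabilityMeasure
  have : ∀ i j, IsProbabilityMeasure (P.map (X i j)) :=
    fun i j ↦ isProbabilityMeasure_map (mX i j).aemeasurable
  have hcurry : (MeasurableEquiv.piCurry 𝓧) ∘ (fun ω q ↦ X q.1 q.2 ω) = fun ω i j ↦ X i j ω := by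
    ext; simp [Sigma.curry]
  have hrow : ∀ i, iIndepFun (X i) P := fun i ↦
    h.precomp (g := fun j : κ i ↦ ⟨i, j⟩) sigma_mk_injective
  rw [iIndepFun_iff_map_fun_eq_infinitePi_map (by fun_prop), ← hcurry,
    ← map_map (by fun_prop) (by fun_prop),
    (iIndepFun_iff_map_fun_eq_infinitePi_map (by fun_prop)).1 h,
    infinitePi_map_piCurry (fun i j ↦ P.map (X i j))]
  congrm infinitePi fun i ↦ ?_
  rw [(iIndepFun_iff_map_fun_eq_infinitePi_map (by fun_prop)).1 (hrow i)]

theorem map_mem_of_isSetBernoulli {X : Ω → Set ι} {u : Set ι} (hX : IsSetBernoulli X u p P) :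
    P.map (fun ω i ↦ i ∈ X ω) = infinitePi fun i ↦
      unitInterval.toNNReal p • dirac (i ∈ u) +
        unitInterval.toNNReal (unitInterval.symm p) • dirac False := by
  have hmem : (fun ω i ↦ i ∈ X ω) = MeasurableEquiv.setOfPred.symm ∘ X := rfl
  rw [hmem, ← AEMeasurable.map_map_of_aemeasurable (by fun_prop) hX.aemeasurable, hX.map_eq,
    setBernoulli_eq_map]
  exact MeasurableEquiv.setOfPred.map_symm_map

theorem iIndepFun_mem_of_isSetBernoulli {X : Ω → Set ι} {u : Set ι} (mX : Measurable X)
    (hX : IsSetBernoulli X u p P) : iIndepFun (fun i ω ↦ i ∈ X ω) P := by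
  have := hX.isProbabilityMeasure
  have mmem : ∀ i, Measurable fun ω ↦ i ∈ X ω := measurable_set_iff.1 mX
  rw [iIndepFun_iff_map_fun_eq_infinitePi_map mmem, map_mem_of_isSetBernoulli hX]
  congrm infinitePi fun i ↦ ?_
  have heval : (fun ω ↦ i ∈ X ω) = (fun x : ι → Prop ↦ x i) ∘ fun ω j ↦ j ∈ X ω := rfl
  rw [heval, ← map_map (by fun_prop) (by fun_prop), map_mem_of_isSetBernoulli hX,
    infinitePi_map_eval]

theorem iIndepFun_preimage_of_isSetBernoulli {κ : Type*} {ι' : κ → Type*} {X : Ω → Set ι}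
    {u : Set ι} (mX : Measurable X) (hX : IsSetBernoulli X u p P) {f : (k : κ) → ι' k → ι}
    (hf : Function.Injective fun q : (k : κ) × ι' k ↦ f q.1 q.2) :
    iIndepFun (fun k ω ↦ f k ⁻¹' X ω) P :=
  (iIndepFun_curry (fun _ _ ↦ measurable_set_iff.1 mX _)
    ((iIndepFun_mem_of_isSetBernoulli mX hX).precomp hf)).comp
    (fun _ ↦ MeasurableEquiv.setOfPred) fun _ ↦ MeasurableEquiv.setOfPred.measurable

theorem isSetBernoulli_preimage {X : Ω → Set ι} {u : Set ι} (hX : IsSetBernoulli X u p P)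
    {f : κ → ι} (hf : Function.Injective f) :
    IsSetBernoulli (fun ω ↦ f ⁻¹' X ω) (f ⁻¹' u) p P := by
  have mpre : Measurable fun s : Set ι ↦ f ⁻¹' s := measurable_set_iff.2 fun _ ↦ by
    simpa only [mem_preimage] using measurable_set_mem _
  refine HasLaw.comp (Y := fun s ↦ f ⁻¹' s) ⟨mpre.aemeasurable, ?_⟩ hX
  have hpre : (fun s : Set ι ↦ f ⁻¹' s) ∘ (fun x : ι → Prop ↦ {i | x i}) =
    (fun y : κ → Prop ↦ {j | y j}) ∘ fun x j ↦ x (f j) := rfl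
  rw [setBernoulli_eq_map, map_map mpre (by exact MeasurableEquiv.setOfPred.measurable), hpre,
    ← map_map (by exact MeasurableEquiv.setOfPred.measurable) (by fun_prop),
    map_infinitePi_infinitePi_of_inj hf, setBernoulli_eq_map]
  rfl

theorem iIndepFun_measureReal_forall {κ : Type*} [Fintype κ] {β : κ → Type*}
    [∀ k, MeasurableSpace (β k)] [∀ k, DiscreteMeasurableSpace (β k)] {X : (k : κ) → Ω → β k}
    (hX : iIndepFun X P) (B : (k : κ) → β k → Prop) :
    P.real {ω | ∀ k, B k (X k ω)} = ∏ k, P.real {ω | B k (X k ω)} := by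
  have h := hX.meas_iInter (s := fun k ↦ {ω | B k (X k ω)}) fun k ↦
    ⟨{b | B k b}, .of_discrete, rfl⟩
  simp only [measureReal_def, ofPred_forall, h, ENNReal.toReal_prod]

end SetBernoulli

section BinomialRandom

open MeasureTheory Measure ProbabilityTheory SimpleGraph Set

open scoped SimpleGraph

variable {V : Type*} {p : unitInterval}

theorem isSetBernoulli_edgeSet [Countable V] :
    IsSetBernoulli (edgeSet : SimpleGraph V → Set (Sym2 V)) Sym2.diagSetᶜ p G(V, p) := by
  refine ⟨measurable_edgeSet.aemeasurable, ?_⟩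
  have hid : edgeSet ∘ fromEdgeSet =ᵐ[setBernoulli Sym2.diagSetᶜ p] (id : Set (Sym2 V) → _) := by
    filter_upwards [setBernoulli_ae_subset] with s hs
    simpa [edgeSet_fromEdgeSet, subset_compl_iff_disjoint_right] using hs
  rw [binomialRandom_eq_map, map_map measurable_edgeSet measurable_fromEdgeSet, map_congr hid,
    Measure.map_id]

instance measurableSingletonClass_simpleGraph [Finite V] :
    MeasurableSingletonClass (SimpleGraph V) where
  measurableSet_singleton G := by
    simpa [Set.preimage, edgeSet_inj] using measurable_edgeSet (measurableSet_singleton G.edgeSet)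

theorem neighborSet_inter_eq_image (G : SimpleGraph V) (x : V) (T : Set V) :
    G.neighborSet x ∩ T = Subtype.val '' ((fun u : T ↦ s(x, (u : V))) ⁻¹' G.edgeSet) := by
  ext u
  simp [and_comm]

theorem iIndepFun_neighborSet_inter [Finite V] {κ : Type*} {x : κ → V} {T : κ → Set V}
    (hinj : Function.Injective fun q : (k : κ) × T k ↦ s(x q.1, (q.2 : V))) :
    iIndepFun (fun k (G : SimpleGraph V) ↦ G.neighborSet (x k) ∩ T k) G(V, p) := by
  simp only [neighborSet_inter_eq_image]
  exact (iIndepFun_preimage_of_isSetBernoulli measurable_edgeSet isSetBernoulli_edgeSet hinj).comp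
    (fun k ↦ image Subtype.val) fun k ↦ .of_discrete

theorem binomialRandom_real_ncard_neighborSet_inter [Finite V] {T : Finset V} {x : V} (hx : x ∉ T)
    (k : ℕ) :
    G(V, p).real {G | (G.neighborSet x ∩ T).ncard = k} =
      (T.card.choose k) * p ^ k * (1 - p) ^ (T.card - k) := by
  let f (u : (T : Set V)) : Sym2 V := s(x, (u : V))
  have hinj : Function.Injective f := fun u v h ↦ Subtype.ext (Sym2.congr_right.1 h)
  have hlaw : IsSetBernoulli (fun G : SimpleGraph V ↦ f ⁻¹' G.edgeSet) univ p G(V, p) := by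
    have hdiag : f ⁻¹' Sym2.diagSetᶜ = univ := eq_univ_of_forall fun u h ↦ by
      have hxu : x = u := by simpa [f] using h
      exact hx (hxu ▸ u.2)
    exact hdiag ▸ isSetBernoulli_preimage isSetBernoulli_edgeSet hinj
  simp only [neighborSet_inter_eq_image, ncard_image_of_injective _ Subtype.val_injective]
  rw [hlaw.measureReal_eq (p := fun s ↦ s.ncard = k) .of_discrete]
  have h := map_ncard_setBernoulli_real_singleton (u := (univ : Set (T : Set V))) (toFinite _) p k
  rw [map_measureReal_apply .of_discrete .of_discrete] at h
  simpa [ncard_univ, preimage] using h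

theorem binomialRandom_real_neighborSet_inter_eq_empty [Finite V] {T : Finset V} {x : V}
    (hx : x ∉ T) :
    G(V, p).real {G | G.neighborSet x ∩ T = ∅} = (1 - p) ^ T.card := by
  simp only [← fun s : Set V ↦ ncard_eq_zero (toFinite s)]
  simpa using binomialRandom_real_ncard_neighborSet_inter (p := p) hx 0

theorem binomialRandom_real_forall_notMem [Fintype V] [DecidableEq V] (U : Finset V)
    (B : V → Set V → Prop) :
    G(V, p).real {G | ∀ x ∉ U, B x (G.neighborSet x ∩ U)} =
      ∏ x ∈ Uᶜ, G(V, p).real {G | B x (G.neighborSet x ∩ U)} := by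
  have hinj : Function.Injective fun q : (_ : {x // x ∈ Uᶜ}) × (U : Set V) ↦
      s((q.1 : V), (q.2 : V)) := by
    rintro ⟨⟨x, hx⟩, u, hu⟩ ⟨⟨y, hy⟩, v, hv⟩ h
    rw [Finset.mem_compl] at hx hy
    rcases Sym2.eq_iff.1 h with ⟨rfl, rfl⟩ | ⟨rfl, rfl⟩
    · rfl
    · exact absurd hv hx
  have h := iIndepFun_measureReal_forall (iIndepFun_neighborSet_inter (p := p) hinj) fun x ↦ B x
  rw [← Finset.prod_coe_sort, ← h]
  simp

end BinomialRandom

section ConflictFree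

open MeasureTheory Measure ProbabilityTheory SimpleGraph Set Function

open scoped SimpleGraph

variable {V α : Type*} {p : unitInterval}

/-- The trace on `T` of a neighborhood `N` that meets a color class in exactly one vertex, when `T`
records that class: the whole class if it has at most two vertices, any three of its vertices
otherwise. Recording at most three vertices keeps the number of possible `T` polynomial. -/
def IsUniqueTrace (T : Finset V) (N : Set V) : Prop :=
  (N ∩ T).ncard = 1 ∨ (N ∩ T).ncard = 0 ∧ 3 ≤ T.card

theorem isUniqueTrace_inter_iff {T : Finset V} {U N : Set V} (hTU : (T : Set V) ⊆ U) :
    IsUniqueTrace T (N ∩ U) ↔ IsUniqueTrace T N := by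
  simp only [IsUniqueTrace, inter_assoc, inter_eq_self_of_subset_right hTU]

theorem exists_isUniqueTrace_of_isConflictFree [Finite V] {G : SimpleGraph V} {c : V → α}
    (hc : G.IsConflictFree c) :
    ∃ T : α → Finset V, (∀ i, (T i).card ≤ 3) ∧ Pairwise (Disjoint on T) ∧
      ∀ x, (∀ i, x ∉ T i) → ∃ i, IsUniqueTrace (T i) (G.neighborSet x) := by
  classical
  have := Fintype.ofFinite V
  let colorClass (i : α) : Finset V := {v | c v = i}
  have hrecord (i : α) : ∃ T ⊆ colorClass i, T.card = min 3 (colorClass i).card :=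
    Finset.exists_subset_card_eq (min_le_right _ _)
  choose T hTc hT using hrecord
  have hcolor : ∀ {i v}, v ∈ T i → c v = i := fun hv ↦ by simpa [colorClass] using hTc _ hv
  refine ⟨T, fun i ↦ (hT i).trans_le (min_le_left _ _), fun i j hij ↦
    Finset.disjoint_left.2 fun v hi hj ↦ hij ((hcolor hi).symm.trans (hcolor hj)), fun x hx ↦ ?_⟩
  obtain ⟨y, hy, hyc⟩ := hc x
  refine ⟨c y, ?_⟩
  have hsub : G.neighborSet x ∩ T (c y) ⊆ {y} := fun z ⟨hz, hzT⟩ ↦ by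
    by_contra hzy
    exact hyc z (mem_insert_of_mem _ hz) hzy (hcolor hzT)
  rcases lt_or_ge (colorClass (c y)).card 3 with hsmall | hlarge
  · have hyT : y ∈ T (c y) := by
      rw [Finset.eq_of_subset_of_card_le (hTc (c y)) (by rw [hT, min_eq_right hsmall.le])]
      simp [colorClass]
    have hyx : y ≠ x := fun h ↦ hx _ (h ▸ hyT)
    exact .inl (ncard_eq_one.2
      ⟨y, hsub.antisymm (singleton_subset_iff.2 ⟨hy.resolve_left hyx, hyT⟩)⟩)
  · rcases subset_singleton_iff_eq.1 hsub with h | h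
    · exact .inr ⟨by rw [h, ncard_empty], by rw [hT, min_eq_left hlarge]⟩
    · exact .inl (by rw [h, ncard_singleton])

theorem binomialRandom_real_isUniqueTrace_le [Finite V] (hp : (1 / 2 : ℝ) ≤ p) {T : Finset V}
    (hT : T.card ≤ 3) {x : V} (hx : x ∉ T) :
    G(V, p).real {G | IsUniqueTrace T (G.neighborSet x)} ≤ p := by
  have hp1 : (p : ℝ) ≤ 1 := p.2.2
  have hone := binomialRandom_real_ncard_neighborSet_inter (p := p) hx 1
  rcases lt_or_eq_of_le hT with hlt | heq
  · have hset : {G : SimpleGraph V | IsUniqueTrace T (G.neighborSet x)} =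
        {G | (G.neighborSet x ∩ T).ncard = 1} := by
      simp [IsUniqueTrace, hlt.not_ge]
    rw [hset, hone]
    interval_cases T.card <;> norm_num <;> nlinarith
  · have hzero := binomialRandom_real_ncard_neighborSet_inter (p := p) hx 0
    calc G(V, p).real {G | IsUniqueTrace T (G.neighborSet x)}
        ≤ G(V, p).real ({G | (G.neighborSet x ∩ T).ncard = 1} ∪
            {G | (G.neighborSet x ∩ T).ncard = 0}) :=
          measureReal_mono fun _ h ↦ h.imp_right And.left
      _ ≤ 3 * p * (1 - p) ^ 2 + (1 - p) ^ 3 := by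
          refine (measureReal_union_le _ _).trans_eq ?_
          rw [hone, hzero, heq]
          norm_num
      _ ≤ p := by nlinarith [mul_nonneg (sub_nonneg.2 hp1) (sub_nonneg.2 hp)]

theorem binomialRandom_real_exists_isUniqueTrace_le [Finite V] [Fintype α]
    (hp : (1 / 2 : ℝ) ≤ p) {T : α → Finset V} (hT : ∀ i, (T i).card ≤ 3)
    (hdisj : Pairwise (Disjoint on T)) {x : V} (hx : ∀ i, x ∉ T i) :
    G(V, p).real {G | ∃ i, IsUniqueTrace (T i) (G.neighborSet x)} ≤
      1 - (1 - p) ^ Fintype.card α := by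
  have hp1 : (p : ℝ) ≤ 1 := p.2.2
  have hinj : Injective fun q : (i : α) × (T i : Set V) ↦ s(x, (q.2 : V)) := by
    rintro ⟨i, u, hu⟩ ⟨j, v, hv⟩ h
    obtain rfl : u = v := Sym2.congr_right.1 h
    obtain rfl : i = j := hdisj.eq (Finset.not_disjoint_iff.2 ⟨u, hu, hv⟩)
    rfl
  have hindep := iIndepFun_measureReal_forall
    (iIndepFun_neighborSet_inter (p := p) (x := fun _ ↦ x) hinj) fun i N ↦ ¬ IsUniqueTrace (T i) N
  simp only [isUniqueTrace_inter_iff subset_rfl] at hindep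
  have hnot (i : α) : 1 - p ≤ G(V, p).real {G | ¬ IsUniqueTrace (T i) (G.neighborSet x)} := by
    rw [← compl_ofPred, probReal_compl_eq_one_sub .of_discrete]
    exact sub_le_sub_left (binomialRandom_real_isUniqueTrace_le hp (hT i) (hx i)) 1
  have hnone : (1 - p : ℝ) ^ Fintype.card α ≤
      G(V, p).real {G | ∀ i, ¬ IsUniqueTrace (T i) (G.neighborSet x)} := by
    rw [hindep, ← Finset.card_univ, ← Finset.prod_const]
    exact Finset.prod_le_prod (fun _ _ ↦ sub_nonneg.2 hp1) fun i _ ↦ hnot i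
  have hcompl : {G : SimpleGraph V | ∃ i, IsUniqueTrace (T i) (G.neighborSet x)} =
      {G | ∀ i, ¬ IsUniqueTrace (T i) (G.neighborSet x)}ᶜ := by
    ext; simp
  rw [hcompl, probReal_compl_eq_one_sub .of_discrete]
  exact sub_le_sub_left hnone 1

theorem binomialRandom_real_forall_exists_isUniqueTrace_le [Fintype V] [Fintype α]
    (hp : (1 / 2 : ℝ) ≤ p) {T : α → Finset V} (hT : ∀ i, (T i).card ≤ 3)
    (hdisj : Pairwise (Disjoint on T)) :
    G(V, p).real {G | ∀ x, (∀ i, x ∉ T i) → ∃ i, IsUniqueTrace (T i) (G.neighborSet x)} ≤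
      (1 - (1 - p) ^ Fintype.card α) ^ (Fintype.card V - 3 * Fintype.card α) := by
  classical
  have hq : (0 : ℝ) ≤ 1 - p := sub_nonneg.2 p.2.2
  have hq1 : (1 - p : ℝ) ≤ 1 := sub_le_self _ p.2.1
  let U : Finset V := Finset.univ.biUnion T
  have hU : U.card ≤ 3 * Fintype.card α := by
    simpa [mul_comm] using Finset.card_biUnion_le_card_mul Finset.univ T 3 fun i _ ↦ hT i
  have hTU (i : α) : (T i : Set V) ⊆ U := by
    exact_mod_cast Finset.subset_biUnion_of_mem T (Finset.mem_univ i)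
  have hindep := binomialRandom_real_forall_notMem (p := p) U fun _ N ↦ ∃ i, IsUniqueTrace (T i) N
  simp only [fun i N ↦ isUniqueTrace_inter_iff (N := N) (hTU i)] at hindep
  have hmem (x : V) : x ∉ U ↔ ∀ i, x ∉ T i := by simp [U]
  simp only [← hmem]
  calc _ = _ := hindep
    _ ≤ ∏ _x ∈ Uᶜ, (1 - (1 - p : ℝ) ^ Fintype.card α) :=
        Finset.prod_le_prod (fun _ _ ↦ measureReal_nonneg) fun x hx ↦
          binomialRandom_real_exists_isUniqueTrace_le hp hT hdisj
            ((hmem x).1 (Finset.mem_compl.1 hx))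
    _ = (1 - (1 - p : ℝ) ^ Fintype.card α) ^ (Fintype.card V - U.card) := by
        rw [Finset.prod_const, Finset.card_compl]
    _ ≤ _ := pow_le_pow_of_le_one (sub_nonneg.2 (pow_le_one₀ hq hq1))
        (sub_le_self _ (pow_nonneg hq _)) (by omega)

theorem card_filter_card_le [Fintype V] (k : ℕ) :
    (Finset.univ.filter fun T : Finset V ↦ T.card ≤ k).card ≤ (Fintype.card V + 1) ^ k := by
  classical
  have hunion : (Finset.univ.filter fun T : Finset V ↦ T.card ≤ k) ⊆
      (Finset.range (k + 1)).biUnion fun i ↦ Finset.powersetCard i Finset.univ := fun T hT ↦ by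
    simpa [Nat.lt_succ_iff] using hT
  calc (Finset.univ.filter fun T : Finset V ↦ T.card ≤ k).card
      ≤ ∑ i ∈ Finset.range (k + 1), (Fintype.card V).choose i := by
        simpa using (Finset.card_le_card hunion).trans Finset.card_biUnion_le
    _ ≤ ∑ i ∈ Finset.range (k + 1), Fintype.card V ^ i * k.choose i :=
        Finset.sum_le_sum fun i hi ↦ (Nat.choose_le_pow _ i).trans
          (Nat.le_mul_of_pos_right _ (Nat.choose_pos (Finset.mem_range_succ_iff.1 hi)))
    _ = (Fintype.card V + 1) ^ k := by simp [add_pow]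

theorem binomialRandom_real_exists_isConflictFree_le [Fintype V] [Fintype α]
    (hp : (1 / 2 : ℝ) ≤ p) :
    G(V, p).real {G | ∃ c : V → α, G.IsConflictFree c} ≤
      ((Fintype.card V + 1 : ℝ) ^ 3) ^ Fintype.card α *
        (1 - (1 - p) ^ Fintype.card α) ^ (Fintype.card V - 3 * Fintype.card α) := by
  classical
  have hq : (0 : ℝ) ≤ 1 - p := sub_nonneg.2 p.2.2
  have hq1 : (1 - p : ℝ) ≤ 1 := sub_le_self _ p.2.1
  let traces : Finset (α → Finset V) := Fintype.piFinset fun _ ↦ {T | T.card ≤ 3}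
  let disjTraces := traces.filter fun T ↦ Pairwise (Disjoint on T)
  let seen (T : α → Finset V) : Set (SimpleGraph V) :=
    {G | ∀ x, (∀ i, x ∉ T i) → ∃ i, IsUniqueTrace (T i) (G.neighborSet x)}
  have hcard : (disjTraces.card : ℝ) ≤ ((Fintype.card V + 1 : ℝ) ^ 3) ^ Fintype.card α := by
    have htraces : traces.card ≤ ((Fintype.card V + 1) ^ 3) ^ Fintype.card α := by
      rw [Fintype.card_piFinset, Finset.prod_const, Finset.card_univ]
      exact Nat.pow_le_pow_left (card_filter_card_le 3) _
    exact_mod_cast (Finset.card_filter_le _ _).trans htraces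
  have hseen : ∀ T ∈ disjTraces, G(V, p).real (seen T) ≤
      (1 - (1 - p) ^ Fintype.card α) ^ (Fintype.card V - 3 * Fintype.card α) := fun T hT ↦ by
    simp only [disjTraces, traces, Finset.mem_filter, Fintype.mem_piFinset, Finset.mem_univ,
      true_and] at hT
    exact binomialRandom_real_forall_exists_isUniqueTrace_le hp hT.1 hT.2
  calc G(V, p).real {G | ∃ c : V → α, G.IsConflictFree c}
      ≤ G(V, p).real (⋃ T ∈ disjTraces, seen T) := by
        refine measureReal_mono (fun G ⟨c, hc⟩ ↦ ?_) (measure_ne_top _ _)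
        obtain ⟨T, hT, hdisj, hx⟩ := exists_isUniqueTrace_of_isConflictFree hc
        exact mem_iUnion₂.2 ⟨T, by simp [disjTraces, traces, hT, hdisj], hx⟩
    _ ≤ ∑ T ∈ disjTraces, G(V, p).real (seen T) := measureReal_biUnion_finset_le _ _
    _ ≤ disjTraces.card * (1 - (1 - p) ^ Fintype.card α) ^
          (Fintype.card V - 3 * Fintype.card α) := by
        simpa only [nsmul_eq_mul] using Finset.sum_le_card_nsmul disjTraces _ _ hseen
    _ ≤ _ := mul_le_mul_of_nonneg_right hcard
        (pow_nonneg (sub_nonneg.2 (pow_le_one₀ hq hq1)) _)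

end ConflictFree

section SecondMoment

open MeasureTheory

variable {Ω ι κ V : Type*} [MeasurableSpace Ω] {P : Measure Ω} [IsFiniteMeasure P]

theorem sq_sum_measureReal_le [Fintype ι] {A : ι → Set Ω} (hA : ∀ i, MeasurableSet (A i)) :
    (∑ i, P.real (A i)) ^ 2 ≤ P.real (⋃ i, A i) * ∑ i, ∑ j, P.real (A i ∩ A j) := by
  have hU : MeasurableSet (⋃ i, A i) := .iUnion hA
  let f (i : ι) : Lp ℝ 2 P := indicatorConstLp 2 (hA i) (measure_ne_top P _) 1
  let u : Lp ℝ 2 P := indicatorConstLp 2 hU (measure_ne_top P _) 1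
  have hff (i j : ι) : inner ℝ (f i) (f j) = P.real (A i ∩ A j) :=
    L2.real_inner_indicatorConstLp_one_indicatorConstLp_one ..
  have hfu (i : ι) : inner ℝ (f i) u = P.real (A i) := by
    rw [L2.real_inner_indicatorConstLp_one_indicatorConstLp_one,
      Set.inter_eq_left.2 (Set.subset_iUnion A i)]
  have huu : inner ℝ u u = P.real (⋃ i, A i) := by
    rw [L2.real_inner_indicatorConstLp_one_indicatorConstLp_one, Set.inter_self]
  have hcs := real_inner_mul_inner_self_le (∑ i, f i) u
  simp only [sum_inner, inner_sum, hff, hfu, huu] at hcs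
  rw [sq, mul_comm (P.real _)]
  refine hcs.trans_eq (congrArg (· * _) Finset.sum_comm)

theorem sum_pow_card_filter_eq [Fintype ι] [DecidableEq ι] [Fintype κ] [DecidableEq κ]
    (f : ι → κ) (z : ℝ) :
    ∑ g : ι → κ, z ^ (Finset.univ.filter fun i ↦ f i = g i).card =
      (Fintype.card κ - 1 + z) ^ Fintype.card ι := by
  have hrow (i : ι) : ∑ k : κ, (if f i = k then z else 1) = Fintype.card κ - 1 + z := by
    have hterm (k : κ) : (if f i = k then z else 1) = 1 + if f i = k then z - 1 else 0 := by
      split_ifs <;> ring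
    simp only [hterm, Finset.sum_add_distrib, Finset.sum_ite_eq, Finset.mem_univ, if_true,
      Finset.sum_const, Finset.card_univ, nsmul_one]
    ring
  calc ∑ g : ι → κ, z ^ (Finset.univ.filter fun i ↦ f i = g i).card
      = ∑ g : ι → κ, ∏ i, if f i = g i then z else 1 := by simp [Finset.prod_ite]
    _ = ∏ i, ∑ k : κ, if f i = k then z else 1 :=
        (Fintype.prod_sum fun i k ↦ if f i = k then z else 1).symm
    _ = (Fintype.card κ - 1 + z) ^ Fintype.card ι := by simp [hrow]

theorem sq_mul_pow_le_measureReal_iUnion [Fintype ι] [Fintype κ] [DecidableEq κ] [Nonempty κ]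
    {A : (ι → κ) → Set Ω} (hA : ∀ f, MeasurableSet (A f)) {c C z : ℝ}
    (hc : ∀ f, P.real (A f) = c)
    (hC : ∀ f g : ι → κ, P.real (A f ∩ A g) ≤ C * z ^ (Finset.univ.filter fun i ↦ f i = g i).card) :
    c ^ 2 * Fintype.card κ ^ Fintype.card ι ≤
      P.real (⋃ f, A f) * (C * (Fintype.card κ - 1 + z) ^ Fintype.card ι) := by
  classical
  have hpos : (0 : ℝ) < Fintype.card κ ^ Fintype.card ι := by
    have : 0 < Fintype.card κ := Fintype.card_pos
    positivity
  refine le_of_mul_le_mul_right ?_ hpos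
  calc c ^ 2 * Fintype.card κ ^ Fintype.card ι * Fintype.card κ ^ Fintype.card ι
      = (∑ f, P.real (A f)) ^ 2 := by
        simp only [hc, Finset.sum_const, Finset.card_univ, Fintype.card_fun, nsmul_eq_mul,
          Nat.cast_pow]
        ring
    _ ≤ P.real (⋃ f, A f) * ∑ f, ∑ g, P.real (A f ∩ A g) := sq_sum_measureReal_le hA
    _ ≤ P.real (⋃ f, A f) *
          ∑ f : ι → κ, ∑ g : ι → κ, C * z ^ (Finset.univ.filter fun i ↦ f i = g i).card := by
        gcongr with f _ g
        exact hC f g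
    _ = _ := by
        simp only [← Finset.mul_sum, sum_pow_card_filter_eq, Finset.sum_const, Finset.card_univ,
          Fintype.card_fun, nsmul_eq_mul, Nat.cast_pow]
        ring

/-- The transversal with `i`-th vertex `e (i, f i)` of the disjoint blocks `e ({i} × κ)`, indexed by
its choice function `f`. The second moment method is run over these sets because two of them meet
exactly in the blocks where their choice functions agree. -/
def transversal [Fintype ι] [DecidableEq V] (e : ι × κ ↪ V) (f : ι → κ) : Finset V :=
  Finset.univ.image fun i ↦ e (i, f i)

theorem injective_graph_comp (e : ι × κ ↪ V) (f : ι → κ) :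
    Function.Injective fun i ↦ e (i, f i) := fun _ _ h ↦ congrArg Prod.fst (e.injective h)

theorem card_transversal [Fintype ι] [DecidableEq V] (e : ι × κ ↪ V) (f : ι → κ) :
    (transversal e f).card = Fintype.card ι :=
  Finset.card_image_of_injective _ (injective_graph_comp e f)

theorem card_transversal_union_add [Fintype ι] [DecidableEq κ] [DecidableEq V] (e : ι × κ ↪ V)
    (f g : ι → κ) :
    (transversal e f ∪ transversal e g).card + (Finset.univ.filter fun i ↦ f i = g i).card =
      2 * Fintype.card ι := by
  have hinter : transversal e f ∩ transversal e g =
      (Finset.univ.filter fun i ↦ f i = g i).image fun i ↦ e (i, f i) := by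
    ext v
    simp only [transversal, Finset.mem_inter, Finset.mem_image, Finset.mem_filter,
      Finset.mem_univ, true_and]
    constructor
    · rintro ⟨⟨i, rfl⟩, j, hj⟩
      obtain ⟨rfl, hfg⟩ := Prod.ext_iff.1 (e.injective hj)
      exact ⟨j, hfg.symm, rfl⟩
    · rintro ⟨i, hfg, rfl⟩
      exact ⟨⟨i, rfl⟩, i, by rw [hfg]⟩
  rw [← Finset.card_image_of_injective _ (injective_graph_comp e f), ← hinter,
    Finset.card_union_add_card_inter, card_transversal, card_transversal, two_mul]

end SecondMoment

section Domination

open MeasureTheory Measure ProbabilityTheory SimpleGraph Set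

open scoped SimpleGraph

variable {V : Type*} {p : unitInterval}

theorem isDominatingSet_iff_forall_notMem {G : SimpleGraph V} {S : Set V} :
    G.IsDominatingSet S ↔ ∀ x ∉ S, G.neighborSet x ∩ S ≠ ∅ := by
  simp only [IsDominatingSet, or_iff_not_imp_left, ← nonempty_iff_ne_empty, Set.Nonempty,
    mem_inter_iff, mem_neighborSet, and_comm]

theorem binomialRandom_real_isDominatingSet [Fintype V] (S : Finset V) :
    G(V, p).real {G | G.IsDominatingSet S} =
      (1 - (1 - p) ^ S.card) ^ (Fintype.card V - S.card) := by
  classical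
  have hmeet : ∀ x ∈ Sᶜ, G(V, p).real {G | G.neighborSet x ∩ S ≠ ∅} = 1 - (1 - p) ^ S.card :=
    fun x hx ↦ by
      rw [← binomialRandom_real_neighborSet_inter_eq_empty (Finset.mem_compl.1 hx),
        ← probReal_compl_eq_one_sub .of_discrete]
      rfl
  have hindep := binomialRandom_real_forall_notMem (p := p) S fun _ N ↦ N ≠ ∅
  simp only [isDominatingSet_iff_forall_notMem, Finset.mem_coe]
  rw [hindep, Finset.prod_congr rfl hmeet, Finset.prod_const, Finset.card_compl]

theorem binomialRandom_real_neighborSet_inter_ne_empty_and [Finite V] [DecidableEq V]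
    {S T : Finset V} {x : V} (hx : x ∉ S ∪ T) :
    G(V, p).real {G | G.neighborSet x ∩ S ≠ ∅ ∧ G.neighborSet x ∩ T ≠ ∅} =
      1 - (1 - p) ^ S.card - (1 - p) ^ T.card + (1 - p) ^ (S ∪ T).card := by
  have hST := Finset.notMem_union.1 hx
  let miss (U : Finset V) : Set (SimpleGraph V) := {G | G.neighborSet x ∩ U = ∅}
  have hinter : miss S ∩ miss T = miss (S ∪ T) := by
    ext G
    simp [miss, inter_union_distrib_left]
  have hunion := measureReal_union_add_inter (μ := G(V, p)) (s := miss S) (t := miss T) .of_discrete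
  rw [hinter, binomialRandom_real_neighborSet_inter_eq_empty hx,
    binomialRandom_real_neighborSet_inter_eq_empty hST.1,
    binomialRandom_real_neighborSet_inter_eq_empty hST.2] at hunion
  have hcompl : {G : SimpleGraph V | G.neighborSet x ∩ S ≠ ∅ ∧ G.neighborSet x ∩ T ≠ ∅} =
      (miss S ∪ miss T)ᶜ := by
    ext G
    simp [miss]
  rw [hcompl, probReal_compl_eq_one_sub .of_discrete]
  linarith

theorem binomialRandom_real_isDominatingSet_inter_le [Fintype V] [DecidableEq V]
    (S T : Finset V) :
    G(V, p).real ({G | G.IsDominatingSet S} ∩ {G | G.IsDominatingSet T}) ≤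
      (1 - (1 - p) ^ S.card - (1 - p) ^ T.card + (1 - p) ^ (S ∪ T).card) ^
        (Fintype.card V - (S ∪ T).card) := by
  have htrace {U : Finset V} (hU : U ⊆ S ∪ T) (N : Set V) :
      N ∩ ((S ∪ T : Finset V) : Set V) ∩ U = N ∩ U := by
    rw [inter_assoc, inter_eq_self_of_subset_right (Finset.coe_subset.2 hU)]
  have hindep := binomialRandom_real_forall_notMem (p := p) (S ∪ T) fun _ N ↦
    N ∩ S ≠ ∅ ∧ N ∩ T ≠ ∅
  simp only [htrace Finset.subset_union_left, htrace Finset.subset_union_right] at hindep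
  calc G(V, p).real ({G | G.IsDominatingSet S} ∩ {G | G.IsDominatingSet T})
      ≤ G(V, p).real {G | ∀ x ∉ S ∪ T, G.neighborSet x ∩ S ≠ ∅ ∧ G.neighborSet x ∩ T ≠ ∅} := by
        refine measureReal_mono fun G ⟨hS, hT⟩ x hx ↦ ?_
        have hST := Finset.notMem_union.1 hx
        exact ⟨isDominatingSet_iff_forall_notMem.1 hS x hST.1,
          isDominatingSet_iff_forall_notMem.1 hT x hST.2⟩
    _ = _ := by
        rw [hindep, Finset.prod_congr rfl fun x hx ↦
          binomialRandom_real_neighborSet_inter_ne_empty_and (Finset.mem_compl.1 hx),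
          Finset.prod_const, Finset.card_compl]

theorem add_mul_pow_sub_pow_add_le {q : ℝ} (hq0 : 0 ≤ q) (hq : q ≤ 1 / 2) (i j : ℕ) :
    (i + j) * (q ^ i - q ^ (i + j)) ≤ j := by
  rcases Nat.eq_zero_or_pos j with rfl | hj
  · simp
  have hij : i + j ≤ j * 2 ^ i := by
    have hi : i + 1 ≤ 2 ^ i := Nat.lt_two_pow_self
    nlinarith
  calc (i + j) * (q ^ i - q ^ (i + j)) ≤ (j * 2 ^ i) * (1 / 2) ^ i := by
        refine mul_le_mul (by exact_mod_cast hij) ?_ ?_ (by positivity)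
        · exact (sub_le_self _ (by positivity)).trans (pow_le_pow_left₀ hq0 hq i)
        · exact sub_nonneg.2 (pow_le_pow_of_le_one hq0 (by linarith) (by omega))
    _ = j := by rw [mul_assoc, ← mul_pow]; norm_num

theorem mul_pow_sub_sq_le {q L N : ℝ} {i j : ℕ} (hq0 : 0 ≤ q) (hq : q ≤ 1 / 2) (hL : 0 ≤ L)
    (hN : N * q ^ (i + j) ≤ (i + j) * L / 2) :
    N * (q ^ (i + j + i) - (q ^ (i + j)) ^ 2) ≤ j * L / 2 :=
  calc N * (q ^ (i + j + i) - (q ^ (i + j)) ^ 2)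
      = N * q ^ (i + j) * (q ^ i - q ^ (i + j)) := by ring
    _ ≤ (i + j) * L / 2 * (q ^ i - q ^ (i + j)) :=
        mul_le_mul_of_nonneg_right hN
          (sub_nonneg.2 (pow_le_pow_of_le_one hq0 (by linarith) (by omega)))
    _ = L / 2 * ((i + j) * (q ^ i - q ^ (i + j))) := by ring
    _ ≤ L / 2 * j :=
        mul_le_mul_of_nonneg_left (add_mul_pow_sub_pow_add_le hq0 hq i j) (by positivity)
    _ = j * L / 2 := by ring

theorem one_sub_sub_add_le_sq_mul_exp {a b : ℝ} (ha : a ≤ 1 / 16) (hab : a ^ 2 ≤ b) :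
    1 - a - a + b ≤ (1 - a) ^ 2 * Real.exp (3 / 2 * (b - a ^ 2)) := by
  have hsq : 2 / 3 ≤ (1 - a) ^ 2 := by nlinarith
  calc 1 - a - a + b = (1 - a) ^ 2 + (b - a ^ 2) := by ring
    _ ≤ (1 - a) ^ 2 * (3 / 2 * (b - a ^ 2) + 1) := by nlinarith [hsq]
    _ ≤ _ := mul_le_mul_of_nonneg_left (Real.add_one_le_exp _) (sq_nonneg _)

theorem one_sub_sub_add_pow_le {q L : ℝ} {n d s j : ℕ} (hq0 : 0 ≤ q) (hq : q ≤ 1 / 2)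
    (hL : 0 ≤ L) (hd : 4 ≤ d) (hjd : j ≤ d) (hs : s + j = 2 * d) (hn : n * q ^ d ≤ d * L / 2) :
    (1 - q ^ d - q ^ d + q ^ s) ^ (n - s) ≤
      ((1 - q ^ d) ^ 2) ^ (n - 2 * d) * Real.exp (3 / 4 * L) ^ j := by
  obtain ⟨i, rfl⟩ := Nat.exists_eq_add_of_le' hjd
  obtain rfl : s = i + j + i := by omega
  have hexcess := mul_pow_sub_sq_le hq0 hq hL (by exact_mod_cast hn)
  set a := q ^ (i + j)
  set b := q ^ (i + j + i) with hb
  have hq1 : q ≤ 1 := by linarith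
  have ha0 : 0 ≤ a := pow_nonneg hq0 _
  have hb0 : 0 ≤ b := pow_nonneg hq0 _
  have ha : a ≤ 1 / 16 :=
    calc a ≤ q ^ 4 := pow_le_pow_of_le_one hq0 hq1 hd
      _ ≤ (1 / 2) ^ 4 := pow_le_pow_left₀ hq0 hq _
      _ = 1 / 16 := by norm_num
  have hab : a ^ 2 ≤ b := by
    rw [hb, pow_add, sq]
    exact mul_le_mul_of_nonneg_left (pow_le_pow_of_le_one hq0 hq1 (Nat.le_add_right i j)) ha0
  calc (1 - a - a + b) ^ (n - (i + j + i))
      ≤ ((1 - a) ^ 2 * Real.exp (3 / 2 * (b - a ^ 2))) ^ (n - (i + j + i)) :=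
        pow_le_pow_left₀ (by linarith) (one_sub_sub_add_le_sq_mul_exp ha hab) _
    _ ≤ ((1 - a) ^ 2) ^ (n - 2 * (i + j)) * Real.exp (3 / 2 * (b - a ^ 2)) ^ n := by
        rw [mul_pow]
        refine mul_le_mul ?_ ?_ (by positivity) (by positivity)
        · exact pow_le_pow_of_le_one (sq_nonneg _)
            (pow_le_one₀ (by linarith) (by linarith)) (by omega)
        · exact pow_le_pow_right₀ (Real.one_le_exp (by linarith)) (Nat.sub_le _ _)
    _ ≤ ((1 - a) ^ 2) ^ (n - 2 * (i + j)) * Real.exp (3 / 4 * L) ^ j := by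
        rw [← Real.exp_nat_mul, ← Real.exp_nat_mul]
        exact mul_le_mul_of_nonneg_left (Real.exp_le_exp.2 (by linarith)) (by positivity)

theorem one_sub_mul_le_of_pow_mul_pow_le {a z P : ℝ} {d m : ℕ} (ha0 : 0 ≤ a) (hz : 1 ≤ z)
    (hm : 1 ≤ m) (h : ((1 - a) ^ 2) ^ d * m ^ d ≤ P * (m - 1 + z) ^ d) :
    1 - d * (2 * a + z / m) ≤ P := by
  have hm' : (1 : ℝ) ≤ m := by exact_mod_cast hm
  have hmz : 0 < (m : ℝ) - 1 + z := by linarith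
  have hfrac : 1 - z / m ≤ m / (m - 1 + z) := by
    rw [le_div_iff₀ hmz]
    have hz0 : 0 ≤ z / m * (z - 1) := mul_nonneg (by positivity) (sub_nonneg.2 hz)
    have hzm : z / m * m = z := by field_simp
    linarith
  have hfrac1 : m / (m - 1 + z) ≤ 1 := by
    rw [div_le_one hmz]; linarith
  have hfrac0 : 0 ≤ m / (m - 1 + z) := by positivity
  let w := (1 - a) ^ 2 * (m / (m - 1 + z))
  have hw0 : 0 ≤ w := by positivity
  have hw : 1 - 2 * a - z / m ≤ w := by
    dsimp only [w]
    nlinarith [mul_nonneg (sq_nonneg a) hfrac0]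
  have hbernoulli := one_add_mul_le_pow (a := w - 1) (by linarith) d
  calc 1 - d * (2 * a + z / m) ≤ 1 + d * (w - 1) := by
        nlinarith [d.cast_nonneg (α := ℝ)]
    _ ≤ w ^ d := by simpa using hbernoulli
    _ ≤ P := by
        rw [mul_pow, div_pow, ← mul_div_assoc, div_le_iff₀ (by positivity)]
        exact h

theorem le_binomialRandom_real_dominationNumber_le [Fintype V] (hp : (1 / 2 : ℝ) ≤ p)
    {d m : ℕ} {L : ℝ} (hL : 0 ≤ L) (hd : 4 ≤ d) (hm : 2 ≤ m) (hdm : d * m ≤ Fintype.card V)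
    (hV : Fintype.card V * (1 - p : ℝ) ^ d ≤ d * L / 2) :
    1 - d * (2 * (1 - p : ℝ) ^ d + Real.exp (3 / 4 * L) / m) ≤
      G(V, p).real {G | G.dominationNumber ≤ d} := by
  classical
  have hq0 : (0 : ℝ) ≤ 1 - p := sub_nonneg.2 p.2.2
  have hq : (1 - p : ℝ) ≤ 1 / 2 := by linarith
  have ha1 : (1 - p : ℝ) ^ d < 1 := pow_lt_one₀ hq0 (by linarith) (by omega)
  have h2d : 2 * d ≤ Fintype.card V := by nlinarith
  obtain ⟨e⟩ : Nonempty (Fin d × Fin m ↪ V) :=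
    Function.Embedding.nonempty_of_card_le (by simpa using hdm)
  have : Nonempty (Fin m) := ⟨⟨0, by omega⟩⟩
  let A (f : Fin d → Fin m) : Set (SimpleGraph V) := {G | G.IsDominatingSet (transversal e f)}
  have hsingle (f : Fin d → Fin m) : G(V, p).real (A f) =
      (1 - (1 - p) ^ d) ^ (Fintype.card V - d) := by
    simp [A, binomialRandom_real_isDominatingSet, card_transversal]
  have hpair (f g : Fin d → Fin m) : G(V, p).real (A f ∩ A g) ≤
      ((1 - (1 - p) ^ d) ^ 2) ^ (Fintype.card V - 2 * d) *
        Real.exp (3 / 4 * L) ^ (Finset.univ.filter fun i ↦ f i = g i).card := by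
    refine (binomialRandom_real_isDominatingSet_inter_le _ _).trans ?_
    rw [card_transversal, card_transversal, Fintype.card_fin]
    exact one_sub_sub_add_pow_le hq0 hq hL hd
      ((Finset.card_le_univ _).trans_eq (Fintype.card_fin d))
      (by simpa using card_transversal_union_add e f g) hV
  have hmoment := sq_mul_pow_le_measureReal_iUnion (fun f ↦ .of_discrete) hsingle hpair
  rw [Fintype.card_fin, Fintype.card_fin] at hmoment
  have hratio : ((1 - (1 - p : ℝ) ^ d) ^ 2) ^ d * m ^ d ≤
      G(V, p).real (⋃ f, A f) * (m - 1 + Real.exp (3 / 4 * L)) ^ d := by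
    have hpos : 0 < ((1 - (1 - p : ℝ) ^ d) ^ 2) ^ (Fintype.card V - 2 * d) :=
      pow_pos (pow_pos (sub_pos.2 ha1) _) _
    refine le_of_mul_le_mul_left (le_trans (le_of_eq ?_) (hmoment.trans_eq ?_)) hpos
    · rw [← mul_assoc, ← pow_add, show Fintype.card V - 2 * d + d = Fintype.card V - d by omega,
        pow_right_comm]
    · ring
  refine (one_sub_mul_le_of_pow_mul_pow_le (pow_nonneg hq0 _)
    (Real.one_le_exp (by positivity)) (by omega) hratio).trans
    (measureReal_mono (iUnion_subset fun f G hG ↦ ?_) (measure_ne_top _ _))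
  exact (dominationNumber_le_card hG).trans_eq (by simp [card_transversal])

end Domination

section Crossover

open Filter MeasureTheory Measure ProbabilityTheory SimpleGraph

open scoped SimpleGraph Topology

theorem exists_crossover {n : ℕ} {q L : ℝ} (hq0 : 0 ≤ q) (hq : q ≤ 1 / 2) (hL : 1 / 2 ≤ L) :
    ∃ r : ℕ, 4 * r * L ≤ n * q ^ r ∧ n * q ^ (r + 1) < 4 * (r + 1) * L := by
  have hex : ∃ r : ℕ, n * q ^ (r + 1) < 4 * (r + 1) * L := by
    refine ⟨n, ?_⟩
    calc n * q ^ (n + 1) ≤ n :=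
          mul_le_of_le_one_right n.cast_nonneg (pow_le_one₀ hq0 (by linarith))
      _ < 4 * (n + 1) * L := by nlinarith [n.cast_nonneg (α := ℝ)]
  classical
  refine ⟨Nat.find hex, ?_, Nat.find_spec hex⟩
  rcases hr : Nat.find hex with _ | r
  · simp
  · simpa using Nat.find_min hex (hr ▸ r.lt_succ_self)

theorem le_two_mul_of_mul_le_mul_pow {n r : ℕ} {q L : ℝ} (hq0 : 0 ≤ q) (hq : q ≤ 1 / 2)
    (hL : 1 / 2 ≤ L) (hn : n ≤ Real.exp L) (h : 4 * r * L ≤ n * q ^ r) : r ≤ 2 * L := by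
  rcases Nat.eq_zero_or_pos r with rfl | hr
  · simpa using (by linarith : 0 ≤ L)
  have hr1 : (1 : ℝ) ≤ r := by exact_mod_cast hr
  have hpow : (2 : ℝ) ^ r ≤ Real.exp L := by
    refine le_trans ?_ hn
    rw [← one_le_div (by positivity)]
    calc 1 ≤ 4 * r * L := by nlinarith
      _ ≤ n * (1 / 2) ^ r := h.trans (by gcongr)
      _ = n / 2 ^ r := by rw [one_div, inv_pow, div_eq_mul_inv]
  have hlog : r * Real.log 2 ≤ L := by
    rw [← Real.log_pow]
    exact (Real.log_le_iff_le_exp (by positivity)).2 hpow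
  nlinarith [Real.log_two_gt_d9]

theorem pow_mul_one_sub_pow_le_exp {n r : ℕ} {a L : ℝ} (ha : a ≤ 1) (hr : 1 ≤ r) (hL : 0 ≤ L)
    (hn : n + 1 = Real.exp L) (hrn : 16 * r ≤ n) (h : 4 * r * L ≤ n * a) :
    ((n + 1 : ℝ) ^ 3) ^ r * (1 - a) ^ (n - 3 * r) ≤ Real.exp (-(L / 4)) := by
  have hr1 : (1 : ℝ) ≤ r := by exact_mod_cast hr
  have hrn' : (16 : ℝ) * r ≤ n := by exact_mod_cast hrn
  have ha0 : 0 ≤ a := by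
    by_contra! ha0
    nlinarith [mul_nonneg (by positivity : (0 : ℝ) ≤ 4 * r) hL]
  calc ((n + 1 : ℝ) ^ 3) ^ r * (1 - a) ^ (n - 3 * r)
      ≤ (Real.exp L ^ 3) ^ r * Real.exp (-a) ^ (n - 3 * r) := by
        rw [hn]
        exact mul_le_mul_of_nonneg_left
          (pow_le_pow_left₀ (sub_nonneg.2 ha) (Real.one_sub_le_exp_neg a) _) (by positivity)
    _ = Real.exp (3 * r * L - (n - 3 * r) * a) := by
        rw [← Real.exp_nat_mul, ← Real.exp_nat_mul, ← Real.exp_nat_mul, ← Real.exp_add,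
          Nat.cast_sub (by omega)]
        push_cast
        ring_nf
    _ ≤ Real.exp (-(L / 4)) := by
        have hna : 13 / 16 * (n * a) ≤ (n - 3 * r) * a := by nlinarith
        have hrL : L ≤ r * L := le_mul_of_one_le_left hL hr1
        exact Real.exp_le_exp.2 (by linarith)

theorem mul_two_mul_add_div_le {a d m n L : ℝ} (hL : 0 ≤ L) (hn : Real.exp L ≤ 2 * n)
    (hd : 0 ≤ d) (hm : 0 < m) (ha : n * a ≤ d * L / 2) (hnm : n ≤ 2 * d * m) :
    d * (2 * a + Real.exp (3 / 4 * L) / m) ≤ d ^ 2 * (2 * L + 4) * Real.exp (-(L / 4)) := by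
  have hmiss : a ≤ d * L * Real.exp (-(L / 4)) := by
    have hn0 : 0 < n := by linarith [Real.exp_pos L]
    have hn1 : 1 ≤ 2 * n * Real.exp (-(L / 4)) :=
      calc 1 ≤ Real.exp L * Real.exp (-(L / 4)) := by
            rw [← Real.exp_add]
            exact Real.one_le_exp (by linarith)
        _ ≤ 2 * n * Real.exp (-(L / 4)) := by gcongr
    refine le_of_mul_le_mul_left ?_ hn0
    calc n * a ≤ d * L / 2 * 1 := by rwa [mul_one]
      _ ≤ d * L / 2 * (2 * n * Real.exp (-(L / 4))) := by gcongr
      _ = n * (d * L * Real.exp (-(L / 4))) := by ring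
  have hcorr : Real.exp (3 / 4 * L) / m ≤ 4 * d * Real.exp (-(L / 4)) := by
    rw [div_le_iff₀ hm]
    calc Real.exp (3 / 4 * L) = Real.exp L * Real.exp (-(L / 4)) := by
          rw [← Real.exp_add]
          ring_nf
      _ ≤ 4 * d * m * Real.exp (-(L / 4)) := by
          gcongr
          linarith
      _ = 4 * d * Real.exp (-(L / 4)) * m := by ring
  calc d * (2 * a + Real.exp (3 / 4 * L) / m)
      ≤ d * (2 * (d * L * Real.exp (-(L / 4))) + 4 * d * Real.exp (-(L / 4))) := by gcongr
    _ = d ^ 2 * (2 * L + 4) * Real.exp (-(L / 4)) := by ring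

variable {V : Type*} [Fintype V] {p : unitInterval} {L : ℝ} {r : ℕ}

theorem binomialRandom_real_exists_isConflictFree_fin_le_exp (hp : (1 / 2 : ℝ) ≤ p) (hL : 0 ≤ L)
    (hV : Fintype.card V + 1 = Real.exp L) (hV0 : 0 < Fintype.card V)
    (hrV : 16 * r ≤ Fintype.card V) (hr : 4 * r * L ≤ Fintype.card V * (1 - p : ℝ) ^ r) :
    G(V, p).real {G | ∃ c : V → Fin r, G.IsConflictFree c} ≤ Real.exp (-(L / 4)) := by
  have hbound := binomialRandom_real_exists_isConflictFree_le (V := V) (α := Fin r) hp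
  rw [Fintype.card_fin] at hbound
  refine hbound.trans ?_
  rcases Nat.eq_zero_or_pos r with rfl | hr0
  · simp [zero_pow hV0.ne', Real.exp_nonneg]
  · exact pow_mul_one_sub_pow_le_exp (pow_le_one₀ (sub_nonneg.2 p.2.2) (sub_le_self _ p.2.1))
      hr0 hL hV hrV hr

theorem one_sub_le_binomialRandom_real_dominationNumber_le_add_four (hp : (1 / 2 : ℝ) ≤ p)
    (hL : 0 ≤ L) (hV : Fintype.card V + 1 = Real.exp L) (hrL : r ≤ 2 * L)
    (hLV : 2 * (2 * L + 4) ≤ Fintype.card V)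
    (hr : Fintype.card V * (1 - p : ℝ) ^ (r + 1) ≤ 4 * (r + 1) * L) :
    1 - (2 * L + 4) ^ 3 * Real.exp (-(L / 4)) ≤
      G(V, p).real {G | G.dominationNumber ≤ (r + 4 : ℕ)} := by
  set n := Fintype.card V
  set d := r + 4 with hdr
  have hd : (d : ℝ) = r + 4 := by rw [hdr]; push_cast; rfl
  have h2d : 2 * d ≤ n := by exact_mod_cast (by linarith : (2 * d : ℝ) ≤ n)
  have hexp : Real.exp L ≤ 2 * n := by linarith
  have hq0 : (0 : ℝ) ≤ 1 - p := sub_nonneg.2 p.2.2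
  have hgain : (1 - p : ℝ) ^ 3 ≤ 1 / 8 :=
    (pow_le_pow_left₀ hq0 (by linarith) 3).trans_eq (by norm_num : (1 / 2 : ℝ) ^ 3 = 1 / 8)
  have hnq : n * (1 - p : ℝ) ^ d ≤ d * L / 2 :=
    calc n * (1 - p : ℝ) ^ d = n * (1 - p) ^ (r + 1) * (1 - p) ^ 3 := by rw [hdr]; ring
      _ ≤ 4 * (r + 1) * L * (1 / 8) := mul_le_mul hr hgain (by positivity) (by positivity)
      _ ≤ d * L / 2 := by rw [hd]; linarith
  have hm : 2 ≤ n / d := (Nat.le_div_iff_mul_le (by omega)).2 h2d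
  have hnm : (n : ℝ) ≤ 2 * d * (n / d : ℕ) := by
    have hlt := Nat.lt_mul_div_succ n (by omega : 0 < d)
    exact_mod_cast (by nlinarith : n ≤ 2 * d * (n / d))
  have hdom := le_binomialRandom_real_dominationNumber_le hp hL (by omega) hm
    (Nat.mul_div_le n d) hnq
  have herror := mul_two_mul_add_div_le hL hexp d.cast_nonneg (by positivity) hnq hnm
  have hcube : (d : ℝ) ^ 2 * (2 * L + 4) ≤ (2 * L + 4) ^ 3 := by
    rw [pow_succ _ 2]
    gcongr
    linarith
  nlinarith [Real.exp_pos (-(L / 4))]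

theorem one_sub_le_binomialRandom_real_dominationNumber_le_conflictFreeChromaticNumber_add_three
    (hp : (1 / 2 : ℝ) ≤ p) (hV : Fintype.card V + 1 = Real.exp L) :
    1 - (1 + (2 * L + 4) ^ 3) * Real.exp (-(L / 4)) ≤
      G(V, p).real {G | G.dominationNumber ≤ G.conflictFreeChromaticNumber + 3} := by
  have hL : 0 ≤ L := Real.one_le_exp_iff.1 (by rw [← hV]; simp)
  rcases lt_or_ge (Fintype.card V : ℝ) (16 * (2 * L + 4)) with hsmall | hlarge
  · have hexp : Real.exp (L / 4) ≤ 1 + (2 * L + 4) ^ 3 :=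
      calc Real.exp (L / 4) ≤ Real.exp L := Real.exp_le_exp.2 (by linarith)
        _ ≤ 1 + 4 ^ 2 * (2 * L + 4) := by linarith
        _ ≤ 1 + (2 * L + 4) ^ 2 * (2 * L + 4) := by gcongr; linarith
        _ = 1 + (2 * L + 4) ^ 3 := by ring
    refine le_trans (sub_nonpos.2 ?_) measureReal_nonneg
    rwa [Real.exp_neg, ← div_eq_mul_inv, one_le_div (Real.exp_pos _)]
  have hq0 : (0 : ℝ) ≤ 1 - p := sub_nonneg.2 p.2.2
  have hq : (1 - p : ℝ) ≤ 1 / 2 := by linarith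
  have hL2 : 1 / 2 ≤ L := by
    by_contra! hL2
    have hexp : Real.exp L ≤ Real.exp 1 := Real.exp_le_exp.2 (by linarith)
    linarith [Real.exp_one_lt_d9]
  obtain ⟨r, hr, hr1⟩ := exists_crossover (n := Fintype.card V) hq0 hq hL2
  have hrL : r ≤ 2 * L := le_two_mul_of_mul_le_mul_pow hq0 hq hL2 (by linarith) hr
  have hrV : 16 * r ≤ Fintype.card V := by
    exact_mod_cast (by linarith : (16 * r : ℝ) ≤ Fintype.card V)
  have hV0 : 0 < Fintype.card V := by exact_mod_cast (by linarith : (0 : ℝ) < Fintype.card V)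
  have hcf := binomialRandom_real_exists_isConflictFree_fin_le_exp hp hL hV hV0 hrV hr
  have hdom := one_sub_le_binomialRandom_real_dominationNumber_le_add_four hp hL hV hrL
    (by linarith) hr1.le
  calc _ ≤ G(V, p).real {G | G.dominationNumber ≤ (r + 4 : ℕ)} -
        G(V, p).real {G | ∃ c : V → Fin r, G.IsConflictFree c} := by linarith
    _ ≤ _ := le_measureReal_sdiff (μ := G(V, p))
    _ ≤ _ := measureReal_mono (fun G hG ↦
        dominationNumber_le_conflictFreeChromaticNumber_add (k := 3) hG.2 hG.1) (measure_ne_top _ _)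

theorem tendsto_one_add_pow_mul_exp_neg :
    Tendsto (fun L : ℝ ↦ (1 + (2 * L + 4) ^ 3) * Real.exp (-(L / 4))) atTop (𝓝 0) := by
  have hpoly := Polynomial.tendsto_div_exp_atTop (1 + (8 * .X + 4) ^ 3)
  refine (hpoly.comp (tendsto_id.atTop_div_const four_pos)).congr fun L ↦ ?_
  have heval : (8 * (L / 4) + 4) = 2 * L + 4 := by ring
  simp [Real.exp_neg, heval, ← div_eq_mul_inv]

theorem tendsto_binomialRandom_dominationNumber_le_conflictFreeChromaticNumber_add_three
    {p : ℕ → unitInterval} (hp : ∀ n, (1 / 2 : ℝ) ≤ p n) :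
    Tendsto (fun n ↦ G(Fin n, p n) {G | G.dominationNumber ≤ G.conflictFreeChromaticNumber + 3})
      atTop (𝓝 1) := by
  have hlog : Tendsto (fun n : ℕ ↦ Real.log (n + 1)) atTop atTop :=
    Real.tendsto_log_atTop.comp (tendsto_atTop_add_const_right _ _ tendsto_natCast_atTop_atTop)
  have hlow := (tendsto_one_add_pow_mul_exp_neg.comp hlog).const_sub 1
  rw [sub_zero] at hlow
  have hreal := tendsto_of_tendsto_of_tendsto_of_le_of_le hlow tendsto_const_nhds
    (fun n ↦
      one_sub_le_binomialRandom_real_dominationNumber_le_conflictFreeChromaticNumber_add_three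
        (V := Fin n) (hp n) (by rw [Fintype.card_fin, Real.exp_log (by positivity)]))
    fun n ↦ measureReal_le_one
  simpa using ENNReal.tendsto_ofReal hreal

end Crossover

theorem theorem2 :
    (∀ {V : Type*} (G : SimpleGraph V),
      G.conflictFreeChromaticNumber ≤ G.dominationNumber + 1) ∧
    (∀ p : ℕ → unitInterval, (∀ n, (1 / 2 : ℝ) ≤ (p n : ℝ)) →
      Filter.Tendsto
        (fun n : ℕ => SimpleGraph.binomialRandom (Fin n) (p n)
          {G : SimpleGraph (Fin n) |
            G.dominationNumber ≤ G.conflictFreeChromaticNumber + 3})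
        Filter.atTop (nhds 1)) :=
  ⟨conflictFreeChromaticNumber_le_dominationNumber_add_one, fun _ ↦
    tendsto_binomialRandom_dominationNumber_le_conflictFreeChromaticNumber_add_three⟩
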